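/- \textbf{The string language.} Fix the following 53 characters: the lower case letters $\mathtt{a},\dots,\mathtt{z}$, the digits $\mathtt 0,\dots,\mathtt 9$, and the 17 characters $\mathtt{"}$, $\backslash$, $=$, $\neq$, $($, $)$, $\sim$, $\&$, $|$, $-$, $>$, $\mathtt A$, $\mathtt E$, $:$, $+$, $*$, $<$. A \emph{string} is a finite sequence of characters. A \emph{string literal} is $\mathtt{"}\beta\mathtt{"}$, where $\beta$ is obtained from some string $\alpha$ by writing $\backslash\mathtt 0$ for each $\backslash$ and $\backslash\mathtt 1$ for each $\mathtt{"}$; it denotes $\alpha$. A \emph{variable} is a lower case letter followed by zero or more digits; its value is a string. A \emph{term} is a non-empty finite sequence of variables and/or string literals; it denotes the concatenation of their values. The \emph{formulae} are the strings $t{=}u$ and $t{\neq}u$ with $t,u$ terms, and $(\pi)$, ${\sim}\pi$, $\pi\&\rho$, $\pi|\rho$, $\pi\mathord{-}\mathord{>}\rho$, $\mathtt Ax{:}\pi$, $\mathtt Ex{:}\pi$ with $\pi,\rho$ formulae and $x$ a variable. Without parentheses they are read with concatenation binding tightest, then $=$ and $\neq$, ${\sim}$, $\&$, $|$, $\mathord{-}\mathord{>}$,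 and finally $:$ (so that the scope of a quantifier reaches as far to the right as possible), and all operators associate to the left. They have the usual meaning, the quantifiers $\mathtt A$ (for all) and $\mathtt E$ (there is) ranging over all strings. A \emph{sentence} is a formula without free variables; it is either true or false. \textbf{Machines.} A \emph{Turing machine} has states $0,\dots,r$ for some $r\ge 1$, a two-way infinite tape whose cells contain one of the 53 characters or a blank, and exactly one rule $(c,q)\mapsto(c',q',d)$ for each tape symbol $c$ and each state $q\ne 0$ (write $c'$, move by $d\in\{\mathtt L,\mathtt R,\mathtt N\}$, enter state $q'$). It starts in state $1$ on the first character of the input string, on an otherwise blank tape, and it halts when it enters state $0$. A \emph{recursively enumerable proof system} is a Turing machine that halts on no string that is not a sentence; it \emph{proves} a sentence if and only if it halts on it. A set of strings is \emph{recursively enumerable} if it is the set of inputs on which some Turing machine halts. \textbf{Theorem 1.} Each recursively enumerable proof system for this first-order language on finite character strings either proves a false sentence or fails to prove a true sentence. Equivalently, the set of true sentences of this language is not recursively enumerable. -/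

import Mathlib

namespace StringTheory

/-- The 53 characters of the language: 26 lower case letters, 10 digits and 17 further characters.
`ne` is the single character written as an overstruck equality sign. -/
inductive Ch where
  | letter (i : Fin 26)
  | digit (i : Fin 10)
  | quote | backslash | eq | ne | lpar | rpar | tilde | amp | bar
  | minus | gt | bigA | bigE | colon | plus | star | lt
  deriving DecidableEq

/-- Finite character strings. -/
abbrev Str : Type := List Ch

/-! ### Syntax -/

/-- The encoded character that denotes a given character: `\0` denotes the backslash, `\1` denotes
the quotation mark, every other character denotes itself. -/
def encodeChar : Ch → Str
  | Ch.backslash => [Ch.backslash, Ch.digit 0]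
  | Ch.quote => [Ch.backslash, Ch.digit 1]
  | c => [c]

/-- The sequence of encoded characters that denotes a given string. -/
def encode (s : Str) : Str := s.flatMap encodeChar

/-- A variable: a lower case letter followed by zero or more digits. -/
structure Var where
  letter : Fin 26
  digits : List (Fin 10)
  deriving DecidableEq

/-- The variable as a string of the language. -/
def Var.render (x : Var) : Str := Ch.letter x.letter :: x.digits.map Ch.digit

/-- A variable or a string literal; a literal is given by the string that it denotes. -/
inductive Item where
  | var (x : Var)
  | lit (s : Str)

/-- The item as a string of the language. -/
def Item.render : Item → Str
  | Item.var x => x.render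
  | Item.lit s => Ch.quote :: encode s ++ [Ch.quote]

/-- A term: a non-empty finite sequence of variables and/or string literals. -/
structure Term where
  items : List Item
  nonempty : items ≠ []

/-- The term as a string of the language. -/
def Term.render (t : Term) : Str := t.items.flatMap Item.render

/-- Syntax trees of formulae. Parentheses are kept in the tree. -/
inductive Formula where
  | eq (t u : Term)
  | ne (t u : Term)
  | paren (p : Formula)
  | neg (p : Formula)
  | and (p q : Formula)
  | or (p q : Formula)
  | imp (p q : Formula)
  | all (x : Var) (p : Formula)
  | ex (x : Var) (p : Formula)

namespace Formula

/-- The formula as a string of the language. -/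
def render : Formula → Str
  | eq t u => t.render ++ [Ch.eq] ++ u.render
  | ne t u => t.render ++ [Ch.ne] ++ u.render
  | paren p => [Ch.lpar] ++ p.render ++ [Ch.rpar]
  | neg p => [Ch.tilde] ++ p.render
  | and p q => p.render ++ [Ch.amp] ++ q.render
  | or p q => p.render ++ [Ch.bar] ++ q.render
  | imp p q => p.render ++ [Ch.minus, Ch.gt] ++ q.render
  | all x p => [Ch.bigA] ++ x.render ++ [Ch.colon] ++ p.render
  | ex x p => [Ch.bigE] ++ x.render ++ [Ch.colon] ++ p.render

/-- Precedence of the outermost operator; a larger number binds tighter. -/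
def prec : Formula → ℕ
  | eq _ _ => 5
  | ne _ _ => 5
  | paren _ => 5
  | neg _ => 4
  | and _ _ => 3
  | or _ _ => 2
  | imp _ _ => 1
  | all _ _ => 0
  | ex _ _ => 0

/-- `p.Open`: the string of `p` ends with the scope of a quantifier that is not enclosed in
parentheses. Since the colon has the lowest precedence, anything that follows (up to the next
unmatched closing parenthesis) would belong to that scope. -/
def Open : Formula → Prop
  | eq _ _ => False
  | ne _ _ => False
  | paren _ => False
  | neg p => p.Open
  | and _ q => q.Open
  | or _ q => q.Open
  | imp _ q => q.Open
  | all _ _ => True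
  | ex _ _ => True

/-- `p` may be the unparenthesised left operand of a left associative operator of precedence `k`. -/
def LeftOperand (k : ℕ) (p : Formula) : Prop := k ≤ p.prec ∧ ¬ p.Open

/-- `p` may be the unparenthesised operand to the right of an operator of precedence `k`, where the
operand must have precedence at least `m`. A quantified formula is always possible there: its
beginning is marked by its quantifier, and its scope reaches as far to the right as possible. -/
def RightOperand (m : ℕ) (p : Formula) : Prop := m ≤ p.prec ∨ p.prec = 0

/-- The tree obeys the precedences (equality, then negation, conjunction, disjunction, implication,
and the colon of quantifiers, from tightest to loosest) and the left associativity of operators. -/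
def WellParsed : Formula → Prop
  | eq _ _ => True
  | ne _ _ => True
  | paren p => p.WellParsed
  | neg p => p.WellParsed ∧ p.RightOperand 4
  | and p q => p.WellParsed ∧ q.WellParsed ∧ p.LeftOperand 3 ∧ q.RightOperand 4
  | or p q => p.WellParsed ∧ q.WellParsed ∧ p.LeftOperand 2 ∧ q.RightOperand 3
  | imp p q => p.WellParsed ∧ q.WellParsed ∧ p.LeftOperand 1 ∧ q.RightOperand 2
  | all _ p => p.WellParsed
  | ex _ p => p.WellParsed

end Formula

/-- The string `s` is a formula of the language, to be read as the syntax tree `p`. -/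
def ReadsAs (s : Str) (p : Formula) : Prop := p.WellParsed ∧ p.render = s

/-! ### Semantics -/

/-- An assignment: each variable contains a string. -/
abbrev Assignment : Type := Var → Str

/-- The string denoted by an item. -/
def Item.value (v : Assignment) : Item → Str
  | Item.var x => v x
  | Item.lit s => s

/-- The string denoted by a term. -/
def Term.value (v : Assignment) (t : Term) : Str := t.items.flatMap (Item.value v)

namespace Formula

/-- The claim expressed by a formula under an assignment. -/
def Holds : Formula → Assignment → Prop
  | eq t u, v => t.value v = u.value v
  | ne t u, v => t.value v ≠ u.value v
  | paren p, v => p.Holds v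
  | neg p, v => ¬ p.Holds v
  | and p q, v => p.Holds v ∧ q.Holds v
  | or p q, v => p.Holds v ∨ q.Holds v
  | imp p q, v => p.Holds v → q.Holds v
  | all x p, v => ∀ s : Str, p.Holds (Function.update v x s)
  | ex x p, v => ∃ s : Str, p.Holds (Function.update v x s)

end Formula

/-- The variables that occur in a term. -/
def Term.vars (t : Term) : Set Var := {x | Item.var x ∈ t.items}

/-- The free variables of a formula. -/
def Formula.freeVars : Formula → Set Var
  | Formula.eq t u => t.vars ∪ u.vars
  | Formula.ne t u => t.vars ∪ u.vars
  | Formula.paren p => p.freeVars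
  | Formula.neg p => p.freeVars
  | Formula.and p q => p.freeVars ∪ q.freeVars
  | Formula.or p q => p.freeVars ∪ q.freeVars
  | Formula.imp p q => p.freeVars ∪ q.freeVars
  | Formula.all x p => p.freeVars \ {x}
  | Formula.ex x p => p.freeVars \ {x}

/-- The string is a sentence: a formula without free variables. -/
def IsSentence (s : Str) : Prop := ∃ p, ReadsAs s p ∧ p.freeVars = ∅

/-- The string is a true sentence. -/
def IsTrueSentence (s : Str) : Prop :=
  ∃ p, ReadsAs s p ∧ p.freeVars = ∅ ∧ ∀ v, p.Holds v

/-- The string is a false sentence. -/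
def IsFalseSentence (s : Str) : Prop :=
  ∃ p, ReadsAs s p ∧ p.freeVars = ∅ ∧ ∀ v, ¬ p.Holds v

/-! ### Turing machines -/

/-- Tape symbols: the 53 characters and the blank `none`. -/
abbrev Symbol : Type := Option Ch

/-- Head movements: left, right, none. -/
inductive Move where
  | L | R | N

/-- The effect of a head movement on a two-way infinite tape. -/
def Move.apply : Move → Turing.Tape Symbol → Turing.Tape Symbol
  | Move.L, T => T.move Turing.Dir.left
  | Move.R, T => T.move Turing.Dir.right
  | Move.N, T => T

/-- A Turing machine with states `0, …, r`, where `0` is the final state, and with exactly one rule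
for each tape symbol and each state other than `0`. -/
structure TuringMachine where
  r : ℕ
  r_pos : 0 < r
  rule : Symbol → (q : Fin (r + 1)) → q ≠ 0 → Symbol × Fin (r + 1) × Move

namespace TuringMachine

/-- A configuration: the state of the control unit, and the tape together with the position of the
read/write head. -/
structure Config (M : TuringMachine) where
  state : Fin (M.r + 1)
  tape : Turing.Tape Symbol

/-- Initially the tape holds the input and is blank elsewhere, the head is on the first character of
the input and the state is `1`. -/
def init (M : TuringMachine) (s : Str) : M.Config where
  state := ⟨1, Nat.succ_lt_succ M.r_pos⟩
  tape := Turing.Tape.mk₁ (s.map some)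

/-- One computation step: write, move, change the state. There is none from the final state. -/
def step (M : TuringMachine) (c : M.Config) : Option M.Config :=
  if h : c.state = 0 then none
  else
    let a := M.rule c.tape.head c.state h
    some ⟨a.2.1, a.2.2.apply (c.tape.write a.1)⟩

/-- The machine eventually halts on input `s`, that is, it reaches the final state. -/
def Halts (M : TuringMachine) (s : Str) : Prop :=
  ∃ c : M.Config, Relation.ReflTransGen (fun a b => M.step a = some b) (M.init s) c ∧ c.state = 0

end TuringMachine

/-- A recursively enumerable proof system: a Turing machine that does not halt on any string that
is not a sentence. -/
structure ProofSystem where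
  machine : TuringMachine
  not_halts : ∀ s : Str, ¬ IsSentence s → ¬ machine.Halts s

/-- A sentence is proven if and only if the machine halts on it. -/
def ProofSystem.Proves (P : ProofSystem) (s : Str) : Prop := IsSentence s ∧ P.machine.Halts s

/-- A set of strings is recursively enumerable: it is the set of inputs on which some Turing machine
halts. -/
def RecursivelyEnumerable (S : Set Str) : Prop :=
  ∃ M : TuringMachine, ∀ s : Str, M.Halts s ↔ s ∈ S

end StringTheory

/-!
Truth is not expressible in the language: otherwise some formula would express the property "the
sentence that states `x` of the string `x` is not true", and the sentence that states this formula
of itself would be true if and only if it is not true. Unique readability ensures that the truth of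
a sentence depends on its string only.

Halting of a given Turing machine is expressible, however. A finite sequence of strings `w₀, …, wₖ`
is coded by the string `d w₀ d w₁ d … wₖ d`, where `d` is a plus sign followed by more stars than
any `wᵢ` has characters, so that the reflexive transitive closure of an expressible relation is
expressible. The configurations of a Turing machine are coded by strings on which it acts by
rewriting, and a string literal arises from the string that it denotes by rewriting, too.
-/

namespace StringTheory

open Relation

/-! ### Unique readability -/

theorem append_cons_inj {α : Type*} {x x' : α} {l₁ l₂ l₁' l₂' : List α}
    (h : x ∈ l₁' → x' ∉ l₂) (h' : x' ∈ l₁ → x ∉ l₂')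
    (e : l₁ ++ x :: l₂ = l₁' ++ x' :: l₂') : l₁ = l₁' ∧ x = x' ∧ l₂ = l₂' := by
  rcases List.append_eq_append_iff.1 e with ⟨m, rfl, hm⟩ | ⟨m, rfl, hm⟩ <;>
    rcases m with _ | ⟨y, m⟩ <;>
    simp only [List.nil_append, List.cons_append, List.cons.injEq] at hm <;>
    obtain ⟨rfl, rfl⟩ := hm
  · simp
  · exact absurd (by simp) (h (by simp))
  · simp
  · exact absurd (by simp) (h' (by simp))

theorem encodeChar_append_inj {c c' : Ch} {m m' : Str}
    (h : encodeChar c ++ m = encodeChar c' ++ m') : c = c' ∧ m = m' := by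
  cases c <;> cases c' <;> simp_all [encodeChar]

theorem quote_notMem_encodeChar (c : Ch) : Ch.quote ∉ encodeChar c := by
  cases c <;> simp [encodeChar]

theorem quote_notMem_encode (s : Str) : Ch.quote ∉ encode s := by
  simp [encode, quote_notMem_encodeChar]

theorem encodeChar_ne_nil (c : Ch) : encodeChar c ≠ [] := by
  cases c <;> simp [encodeChar]

theorem encode_injective : Function.Injective encode := by
  intro s
  induction s with
  | nil => rintro (_ | ⟨c, s⟩) h <;> simp_all [encode, encodeChar_ne_nil]
  | cons c s ih =>
    rintro (_ | ⟨c', s'⟩) h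
    · simp [encode, encodeChar_ne_nil] at h
    · obtain ⟨rfl, hs⟩ := encodeChar_append_inj (by simpa only [encode, List.flatMap_cons] using h)
      rw [ih hs]

theorem digits_append_inj {ds ds' : List (Fin 10)} {m m' : Str}
    (hm : ∀ i, m.head? ≠ some (Ch.digit i)) (hm' : ∀ i, m'.head? ≠ some (Ch.digit i))
    (h : ds.map Ch.digit ++ m = ds'.map Ch.digit ++ m') : ds = ds' ∧ m = m' := by
  induction ds generalizing ds' with
  | nil => cases ds' <;> simp_all
  | cons d ds ih =>
    cases ds' with
    | nil => exact absurd (congrArg List.head? h.symm) (by simpa using hm' d)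
    | cons d' ds' =>
      obtain ⟨hd, h⟩ : d = d' ∧ _ := by simpa using h
      obtain ⟨rfl, rfl⟩ := ih h
      exact ⟨by rw [hd], rfl⟩

/-- The characters with which a variable or a string literal begins. -/
def Ch.StartsItem : Ch → Prop
  | letter _ | quote => True
  | _ => False

/-- The string cannot continue a term: it is empty or its first character neither starts an item
nor is a digit, which would prolong a variable. -/
def EndsTerm (m : Str) : Prop := ∀ c ∈ m.head?, ¬ c.StartsItem ∧ ∀ i, c ≠ Ch.digit i

theorem Item.exists_render_eq_cons (i : Item) : ∃ c n, c.StartsItem ∧ i.render = c :: n := by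
  cases i with
  | var x => exact ⟨.letter x.letter, _, trivial, rfl⟩
  | lit s => exact ⟨.quote, _, trivial, rfl⟩

theorem Term.exists_render_eq_cons (t : Term) : ∃ c n, c.StartsItem ∧ t.render = c :: n := by
  obtain ⟨_ | ⟨i, is⟩, h⟩ := t
  · exact absurd rfl h
  · obtain ⟨c, n, hc, hi⟩ := i.exists_render_eq_cons
    exact ⟨c, n ++ is.flatMap Item.render, hc, by simp [Term.render, hi]⟩

theorem Term.startsItem_of_render_append {t : Term} {c : Ch} {m n : Str}
    (h : t.render ++ m = c :: n) : c.StartsItem := by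
  obtain ⟨c', k, hc', ht⟩ := t.exists_render_eq_cons
  rw [ht, List.cons_append, List.cons.injEq] at h
  exact h.1 ▸ hc'

theorem EndsTerm.head?_append_ne_digit {m : Str} (hm : EndsTerm m) (is : List Item) (i : Fin 10) :
    (is.flatMap Item.render ++ m).head? ≠ some (Ch.digit i) := by
  cases is with
  | nil => exact fun h => (hm _ h).2 i rfl
  | cons j is =>
    obtain ⟨c, n, hc, hj⟩ := j.exists_render_eq_cons
    rintro h
    obtain rfl : c = Ch.digit i := by simpa [hj] using h
    exact hc

theorem EndsTerm.ne_item_append {m : Str} (hm : EndsTerm m) (i : Item) (n : Str) :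
    m ≠ i.render ++ n := by
  rintro rfl
  obtain ⟨c, k, hc, hi⟩ := i.exists_render_eq_cons
  exact (hm c (by simp [hi])).1 hc

theorem Item.render_append_inj {i i' : Item} {m m' : Str}
    (hm : ∀ i, m.head? ≠ some (Ch.digit i)) (hm' : ∀ i, m'.head? ≠ some (Ch.digit i))
    (h : i.render ++ m = i'.render ++ m') : i = i' ∧ m = m' := by
  rcases i with ⟨l, ds⟩ | s <;> rcases i' with ⟨l', ds'⟩ | s' <;>
    simp only [Item.render, Var.render, List.cons_append, List.cons.injEq, reduceCtorEq,
      false_and, true_and, List.append_assoc, List.nil_append, Ch.letter.injEq] at h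
  · obtain ⟨rfl, h⟩ := h
    obtain ⟨rfl, rfl⟩ := digits_append_inj hm hm' h
    exact ⟨rfl, rfl⟩
  · obtain ⟨hs, -, rfl⟩ := append_cons_inj (absurd · (quote_notMem_encode s'))
      (absurd · (quote_notMem_encode s)) h
    rw [encode_injective hs]
    exact ⟨rfl, rfl⟩

theorem Term.render_append_inj {t t' : Term} {m m' : Str} (hm : EndsTerm m) (hm' : EndsTerm m')
    (h : t.render ++ m = t'.render ++ m') : t = t' ∧ m = m' := by
  obtain ⟨is, _⟩ := t
  obtain ⟨is', _⟩ := t'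
  suffices is = is' ∧ m = m' by simpa using this
  simp only [Term.render] at h
  clear * - hm hm' h
  induction is generalizing is' with
  | nil =>
    cases is' with
    | nil => simpa using h
    | cons i' is' => exact absurd h (by simpa using hm.ne_item_append i' _)
  | cons i is ih =>
    cases is' with
    | nil => exact absurd h.symm (by simpa using hm'.ne_item_append i _)
    | cons i' is' =>
      simp only [List.flatMap_cons, List.append_assoc] at h
      obtain ⟨rfl, his⟩ := Item.render_append_inj (hm.head?_append_ne_digit is)
        (hm'.head?_append_ne_digit is') h
      obtain ⟨rfl, rfl⟩ := ih is' his
      exact ⟨rfl, rfl⟩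

theorem Term.render_append_cons_render_append_inj {t t' u u' : Term} {c c' : Ch} {m m' : Str}
    (hc : c = Ch.eq ∨ c = Ch.ne) (hc' : c' = Ch.eq ∨ c' = Ch.ne) (hm : EndsTerm m)
    (hm' : EndsTerm m')
    (h : t.render ++ c :: (u.render ++ m) = t'.render ++ c' :: (u'.render ++ m')) :
    t = t' ∧ c = c' ∧ u = u' ∧ m = m' := by
  have hends : ∀ {c n}, c = Ch.eq ∨ c = Ch.ne → EndsTerm (c :: n) := by
    rintro _ _ (rfl | rfl) <;> simp [EndsTerm, Ch.StartsItem]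
  obtain ⟨ht, h⟩ := Term.render_append_inj (hends hc) (hends hc') h
  obtain ⟨hcc, h⟩ := List.cons.inj h
  exact ⟨ht, hcc, Term.render_append_inj hm hm' h⟩

theorem Var.render_append_colon_inj {x x' : Var} {m m' : Str}
    (h : x.render ++ Ch.colon :: m = x'.render ++ Ch.colon :: m') : x = x' ∧ m = m' := by
  simpa using Item.render_append_inj (i := .var x) (i' := .var x') (by simp) (by simp) h

/-- The binary connectives. -/
inductive Connective where
  | and | or | imp

namespace Connective

/-- The connective as a string of the language. -/
def render : Connective → Str
  | and => [Ch.amp]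
  | or => [Ch.bar]
  | imp => [Ch.minus, Ch.gt]

/-- The precedence of the formulae with this outermost connective. -/
def prec : Connective → ℕ
  | and => 3
  | or => 2
  | imp => 1

/-- The formula with the given outermost connective and operands. -/
def join : Connective → Formula → Formula → Formula
  | and => Formula.and
  | or => Formula.or
  | imp => Formula.imp

variable (c : Connective) (p q : Formula)

theorem render_join : (c.join p q).render = p.render ++ c.render ++ q.render := by
  cases c <;> rfl

theorem prec_join : (c.join p q).prec = c.prec := by
  cases c <;> rfl

theorem open_join : (c.join p q).Open ↔ q.Open := by
  cases c <;> rfl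

theorem wellParsed_join : (c.join p q).WellParsed ↔
    p.WellParsed ∧ q.WellParsed ∧ p.LeftOperand c.prec ∧ q.RightOperand (c.prec + 1) := by
  cases c <;> rfl

theorem render_append_inj {c c' : Connective} {m m' : Str}
    (h : c.render ++ m = c'.render ++ m') : c = c' ∧ m = m' := by
  cases c <;> cases c' <;> simp_all [render]

theorem endsTerm_render_append (m : Str) : EndsTerm (c.render ++ m) := by
  cases c <;> simp [render, EndsTerm, Ch.StartsItem]

end Connective

namespace Formula

/-- The leftmost operand in the decomposition of a formula into operands that are not themselves
binary, disregarding the order in which the connectives are applied. -/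
def head : Formula → Formula
  | and p _ | or p _ | imp p _ => p.head
  | p => p

/-- The operands after the leftmost one, each together with the connective in front of it. -/
def tail : Formula → List (Connective × Formula)
  | and p q => p.tail ++ (Connective.and, q.head) :: q.tail
  | or p q => p.tail ++ (Connective.or, q.head) :: q.tail
  | imp p q => p.tail ++ (Connective.imp, q.head) :: q.tail
  | _ => []

/-- The string formed by a sequence of connectives, each followed by an operand. -/
def renderTail (l : List (Connective × Formula)) : Str :=
  l.flatMap fun x => x.1.render ++ x.2.render

section Join

variable (c : Connective) (p q : Formula)

theorem head_join : (c.join p q).head = p.head := by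
  cases c <;> rfl

theorem tail_join : (c.join p q).tail = p.tail ++ (c, q.head) :: q.tail := by
  cases c <;> rfl

end Join

@[elab_as_elim]
theorem join_induction {motive : Formula → Prop} (operand : ∀ p, p.tail = [] → motive p)
    (join : ∀ (c : Connective) p q, motive p → motive q → motive (c.join p q)) (p : Formula) :
    motive p := by
  induction p with
  | and p q ihp ihq => exact join .and p q ihp ihq
  | or p q ihp ihq => exact join .or p q ihp ihq
  | imp p q ihp ihq => exact join .imp p q ihp ihq
  | _ => exact operand _ rfl

theorem exists_eq_join {p : Formula} (h : p.tail ≠ []) : ∃ c q r, p = Connective.join c q r := by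
  induction p using join_induction with
  | operand p hp => exact absurd hp h
  | join c q r => exact ⟨c, q, r, rfl⟩

theorem head_eq_self {p : Formula} (h : p.tail = []) : p.head = p := by
  cases p <;> simp_all [tail, head]

theorem tail_eq_nil_of_rightOperand_four {p : Formula} (h : p.RightOperand 4) : p.tail = [] := by
  cases p <;> simp_all [RightOperand, prec, tail]

theorem render_head_append_renderTail (p : Formula) :
    p.head.render ++ renderTail p.tail = p.render := by
  induction p using join_induction with
  | operand p hp => simp [hp, head_eq_self hp, renderTail]
  | join c p q ihp ihq =>
    rw [c.render_join, ← ihp, ← ihq, head_join, tail_join]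
    simp [renderTail]

theorem tail_eq_nil_of_prec_eq_zero {p : Formula} (h : p.prec = 0) : p.tail = [] := by
  cases p <;> simp_all [prec, tail]

theorem WellParsed.prec_le_of_mem_tail {p : Formula} (hp : p.WellParsed) :
    ∀ x ∈ p.tail, p.prec ≤ x.1.prec := by
  induction p using join_induction with
  | operand p h => simp [h]
  | join c p q ihp ihq =>
    obtain ⟨hp, hq, ⟨hcp, -⟩, hcq⟩ := (c.wellParsed_join p q).1 hp
    simp only [c.prec_join, tail_join, List.mem_append, List.mem_cons]
    rintro x (hx | rfl | hx)
    · exact hcp.trans (ihp hp x hx)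
    · exact le_rfl
    · rcases hcq with hcq | h0
      · exact (Nat.le_of_succ_le hcq).trans (ihq hq x hx)
      · simp [tail_eq_nil_of_prec_eq_zero h0] at hx

theorem lt_prec_of_rightOperand {k : ℕ} {p : Formula} (hp : p.WellParsed)
    (h : p.RightOperand (k + 1)) : ∀ x ∈ p.tail, k < x.1.prec := by
  rcases h with h | h0
  · exact fun x hx => Nat.lt_of_succ_le (h.trans (hp.prec_le_of_mem_tail x hx))
  · simp [tail_eq_nil_of_prec_eq_zero h0]

-- The outermost connective is the last one of least precedence.
theorem WellParsed.eq_of_head_eq_of_tail_eq {p q : Formula} (hp : p.WellParsed)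
    (hq : q.WellParsed) (hh : p.head = q.head) (ht : p.tail = q.tail) : p = q := by
  induction p using join_induction generalizing q with
  | operand p h => rwa [head_eq_self h, head_eq_self (ht ▸ h)] at hh
  | join c p₁ p₂ ih₁ ih₂ =>
    obtain ⟨c', q₁, q₂, rfl⟩ := exists_eq_join (p := q) (by simp [← ht, tail_join])
    simp only [head_join, tail_join] at hh ht
    obtain ⟨hp₁, hp₂, hl, hr⟩ := (c.wellParsed_join p₁ p₂).1 hp
    obtain ⟨hq₁, hq₂, hl', hr'⟩ := (c'.wellParsed_join q₁ q₂).1 hq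
    obtain ⟨ht₁, hc, ht₂⟩ := append_cons_inj
      (fun h h' => (lt_prec_of_rightOperand hp₂ hr _ h').not_ge
        (hl'.1.trans (hq₁.prec_le_of_mem_tail _ h)))
      (fun h h' => (lt_prec_of_rightOperand hq₂ hr' _ h').not_ge
        (hl.1.trans (hp₁.prec_le_of_mem_tail _ h))) ht
    obtain ⟨rfl, hh₂⟩ := Prod.ext_iff.1 hc
    rw [ih₁ hp₁ hq₁ hh ht₁, ih₂ hp₂ hq₂ hh₂ ht₂]

/-- The formula `a` and the operands in `l` are well parsed, none of them is binary, and the scope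
of a quantifier can end only the last one. -/
def IsChain (a : Formula) : List (Connective × Formula) → Prop
  | [] => a.WellParsed ∧ a.tail = []
  | x :: l => a.WellParsed ∧ a.tail = [] ∧ ¬ a.Open ∧ IsChain x.2 l

theorem WellParsed.isChain_append {p : Formula} (hp : p.WellParsed) :
    IsChain p.head p.tail ∧ ∀ c b l, ¬ p.Open → IsChain b l →
      IsChain p.head (p.tail ++ (c, b) :: l) := by
  induction p using join_induction with
  | operand p h => simp +contextual [h, head_eq_self h, IsChain, hp]
  | join c p q ihp ihq =>
    obtain ⟨hp, hq, ⟨-, ho⟩, -⟩ := (c.wellParsed_join p q).1 hp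
    simp only [head_join, tail_join, c.open_join, List.append_assoc, List.cons_append]
    exact ⟨(ihp hp).2 _ _ _ ho (ihq hq).1,
      fun c' b l hqo hl => (ihp hp).2 _ _ _ ho ((ihq hq).2 _ _ _ hqo hl)⟩

/-- The string is empty or begins with a closing parenthesis, hence ends the scope of every
unparenthesised quantifier before it. -/
def Closes (r : Str) : Prop := ∀ c ∈ r.head?, c = Ch.rpar

theorem Closes.endsTerm {r : Str} (h : Closes r) : EndsTerm r := by
  intro c hc
  simp [h c hc, Ch.StartsItem]

theorem Closes.render_append_ne {r : Str} (h : Closes r) (c : Connective) (m : Str) :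
    r ≠ c.render ++ m := by
  rintro rfl
  cases c <;> simp [Closes, Connective.render] at h

/-- The operand `a` can be recognised at the beginning of a string in which it is followed by
something that ends it. -/
def IsReadable (a : Formula) : Prop :=
  ∀ ⦃b m m'⦄, b.WellParsed → b.tail = [] → EndsTerm m → EndsTerm m' → (a.Open → Closes m) →
    (b.Open → Closes m') → a.render ++ m = b.render ++ m' → a = b ∧ m = m'

theorem endsTerm_renderTail_append (l : List (Connective × Formula)) {r : Str} (hr : Closes r) :
    EndsTerm (renderTail l ++ r) := by
  cases l with
  | nil => exact hr.endsTerm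
  | cons x l => simpa [renderTail] using x.1.endsTerm_render_append _

theorem IsChain.closes {a : Formula} {l : List (Connective × Formula)} (h : IsChain a l)
    (ha : a.Open) {r : Str} (hr : Closes r) : Closes (renderTail l ++ r) := by
  cases l with
  | nil => exact hr
  | cons x l => exact absurd ha h.2.2.1

theorem IsChain.wellParsed {a : Formula} {l : List (Connective × Formula)} (h : IsChain a l) :
    a.WellParsed ∧ a.tail = [] := by
  cases l with
  | nil => exact h
  | cons x l => exact ⟨h.1, h.2.1⟩

theorem IsChain.eq_of_head_render_eq {a b : Formula} {l l' : List (Connective × Formula)}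
    {r r' : Str} (h' : IsChain b l') (ha : IsReadable a) (h : IsChain a l)
    (hr : Closes r) (hr' : Closes r')
    (e : a.render ++ (renderTail l ++ r) = b.render ++ (renderTail l' ++ r')) :
    a = b ∧ renderTail l ++ r = renderTail l' ++ r' :=
  ha h'.wellParsed.1 h'.wellParsed.2 (endsTerm_renderTail_append l hr)
    (endsTerm_renderTail_append l' hr') (h.closes · hr) (h'.closes · hr') e

theorem IsChain.eq_of_render_eq {a b : Formula} {l l' : List (Connective × Formula)} {r r' : Str}
    (ha : IsReadable a) (hl : ∀ x ∈ l, x.2.IsReadable) (h : IsChain a l) (h' : IsChain b l')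
    (hr : Closes r) (hr' : Closes r')
    (e : a.render ++ (renderTail l ++ r) = b.render ++ (renderTail l' ++ r')) :
    a = b ∧ l = l' ∧ r = r' := by
  induction l generalizing a b l' with
  | nil =>
    obtain ⟨rfl, et⟩ := h'.eq_of_head_render_eq ha h hr hr' e
    cases l' with
    | nil => exact ⟨rfl, rfl, et⟩
    | cons x' l' => exact absurd et (by simpa [renderTail] using hr.render_append_ne x'.1 _)
  | cons x l ih =>
    obtain ⟨rfl, et⟩ := h'.eq_of_head_render_eq ha h hr hr' e
    cases l' with
    | nil => exact absurd et.symm (by simpa [renderTail] using hr'.render_append_ne x.1 _)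
    | cons x' l' =>
      simp only [renderTail, List.flatMap_cons, List.append_assoc] at et
      obtain ⟨hc, ex⟩ := Connective.render_append_inj et
      obtain ⟨hx, rfl, rfl⟩ := ih (hl x (by simp)) (fun y hy => hl y (by simp [hy]))
        h.2.2.2 h'.2.2.2 ex
      exact ⟨rfl, by rw [Prod.ext hc hx], rfl⟩

theorem isReadable_eq (t u : Term) : IsReadable (eq t u) := by
  intro b m m' _ hb hm hm' _ _ e
  cases b with
  | eq t' u' =>
    obtain ⟨rfl, -, rfl, rfl⟩ := Term.render_append_cons_render_append_inj (.inl rfl) (.inl rfl)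
      hm hm' (by simpa [render] using e)
    exact ⟨rfl, rfl⟩
  | ne t' u' =>
    cases (Term.render_append_cons_render_append_inj (c := Ch.eq) (c' := Ch.ne) (.inl rfl)
      (.inr rfl) hm hm' (by simpa [render] using e)).2.1
  | and | or | imp => simp [tail] at hb
  | _ =>
    simp only [render, List.append_assoc] at e
    exact False.elim (Term.startsItem_of_render_append e)

theorem isReadable_ne (t u : Term) : IsReadable (ne t u) := by
  intro b m m' _ hb hm hm' _ _ e
  cases b with
  | ne t' u' =>
    obtain ⟨rfl, -, rfl, rfl⟩ := Term.render_append_cons_render_append_inj (.inr rfl) (.inr rfl)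
      hm hm' (by simpa [render] using e)
    exact ⟨rfl, rfl⟩
  | eq t' u' =>
    cases (Term.render_append_cons_render_append_inj (c := Ch.ne) (c' := Ch.eq) (.inr rfl)
      (.inl rfl) hm hm' (by simpa [render] using e)).2.1
  | and | or | imp => simp [tail] at hb
  | _ =>
    simp only [render, List.append_assoc] at e
    exact False.elim (Term.startsItem_of_render_append e)

/-- Every operand of the formula is readable. -/
def HasReadableOperands (p : Formula) : Prop :=
  p.head.IsReadable ∧ ∀ x ∈ p.tail, x.2.IsReadable

theorem HasReadableOperands.render_append_inj {p q : Formula}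
    (h : p.HasReadableOperands) (hp : p.WellParsed) (hq : q.WellParsed) {r r' : Str}
    (hr : Closes r) (hr' : Closes r') (e : p.render ++ r = q.render ++ r') : p = q ∧ r = r' := by
  rw [← p.render_head_append_renderTail, ← q.render_head_append_renderTail, List.append_assoc,
    List.append_assoc] at e
  obtain ⟨hh, ht, rfl⟩ :=
    IsChain.eq_of_render_eq h.1 h.2 hp.isChain_append.1 hq.isChain_append.1 hr hr' e
  exact ⟨hp.eq_of_head_eq_of_tail_eq hq hh ht, rfl⟩

theorem isReadable_paren {p : Formula} (hp : p.WellParsed) (h : p.HasReadableOperands) :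
    IsReadable (paren p) := by
  intro b m m' hbw hb _ _ _ _ e
  cases b with
  | paren q =>
    simp only [render, List.append_assoc] at e
    obtain ⟨rfl, em⟩ := h.render_append_inj (q := q) hp hbw (by simp [Closes])
      (by simp [Closes]) (List.append_cancel_left e)
    exact ⟨rfl, List.append_cancel_left em⟩
  | and | or | imp => simp [tail] at hb
  | eq | ne =>
    simp only [render, List.append_assoc] at e
    exact False.elim (Term.startsItem_of_render_append e.symm)
  | _ => simp [render] at e

theorem isReadable_neg {p : Formula} (h : p.IsReadable) :
    IsReadable (neg p) := by
  intro b m m' hbw hb hm hm' ho ho' e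
  cases b with
  | neg q =>
    simp only [render, List.append_assoc] at e
    obtain ⟨rfl, rfl⟩ := h hbw.1 (tail_eq_nil_of_rightOperand_four hbw.2) hm hm' ho ho'
      (List.append_cancel_left e)
    exact ⟨rfl, rfl⟩
  | and | or | imp => simp [tail] at hb
  | eq | ne =>
    simp only [render, List.append_assoc] at e
    exact False.elim (Term.startsItem_of_render_append e.symm)
  | _ => simp [render] at e

theorem isReadable_all {p : Formula} (hp : p.WellParsed) (h : p.HasReadableOperands) (x : Var) :
    IsReadable (all x p) := by
  intro b m m' hbw hb _ _ ho ho' e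
  cases b with
  | all y q =>
    simp only [render, List.append_assoc] at e
    obtain ⟨rfl, ep⟩ := Var.render_append_colon_inj (List.append_cancel_left e)
    obtain ⟨rfl, rfl⟩ := h.render_append_inj (q := q) hp hbw (ho trivial) (ho' trivial) ep
    exact ⟨rfl, rfl⟩
  | and | or | imp => simp [tail] at hb
  | eq | ne =>
    simp only [render, List.append_assoc] at e
    exact False.elim (Term.startsItem_of_render_append e.symm)
  | _ => simp [render] at e

theorem isReadable_ex {p : Formula} (hp : p.WellParsed) (h : p.HasReadableOperands) (x : Var) :
    IsReadable (ex x p) := by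
  intro b m m' hbw hb _ _ ho ho' e
  cases b with
  | ex y q =>
    simp only [render, List.append_assoc] at e
    obtain ⟨rfl, ep⟩ := Var.render_append_colon_inj (List.append_cancel_left e)
    obtain ⟨rfl, rfl⟩ := h.render_append_inj (q := q) hp hbw (ho trivial) (ho' trivial) ep
    exact ⟨rfl, rfl⟩
  | and | or | imp => simp [tail] at hb
  | eq | ne =>
    simp only [render, List.append_assoc] at e
    exact False.elim (Term.startsItem_of_render_append e.symm)
  | _ => simp [render] at e

theorem hasReadableOperands_join (c : Connective) {p q : Formula} (hp : p.HasReadableOperands)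
    (hq : q.HasReadableOperands) : (c.join p q).HasReadableOperands := by
  simp only [HasReadableOperands, head_join, tail_join, List.mem_append, List.mem_cons]
  refine ⟨hp.1, ?_⟩
  rintro x (hx | rfl | hx)
  exacts [hp.2 x hx, hq.1, hq.2 x hx]

theorem WellParsed.hasReadableOperands {p : Formula} (hp : p.WellParsed) :
    p.HasReadableOperands := by
  induction p with
  | eq t u => exact ⟨isReadable_eq t u, by simp [tail]⟩
  | ne t u => exact ⟨isReadable_ne t u, by simp [tail]⟩
  | paren p ih => exact ⟨isReadable_paren hp (ih hp), by simp [tail]⟩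
  | neg p ih =>
    have ht := tail_eq_nil_of_rightOperand_four hp.2
    exact ⟨isReadable_neg (head_eq_self ht ▸ (ih hp.1).1), by simp [tail]⟩
  | and p q ihp ihq => exact hasReadableOperands_join .and (ihp hp.1) (ihq hp.2.1)
  | or p q ihp ihq => exact hasReadableOperands_join .or (ihp hp.1) (ihq hp.2.1)
  | imp p q ihp ihq => exact hasReadableOperands_join .imp (ihp hp.1) (ihq hp.2.1)
  | all x p ih => exact ⟨isReadable_all (p := p) hp (ih hp) x, by simp [tail]⟩
  | ex x p ih => exact ⟨isReadable_ex (p := p) hp (ih hp) x, by simp [tail]⟩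

end Formula

theorem ReadsAs.unique {s : Str} {p q : Formula} (hp : ReadsAs s p) (hq : ReadsAs s q) : p = q :=
  (hp.1.hasReadableOperands.render_append_inj hp.1 hq.1 (by simp [Formula.Closes])
    (by simp [Formula.Closes]) (congrArg (· ++ []) (hp.2.trans hq.2.symm))).1

/-! ### Expressible relations -/

theorem Term.value_congr {t : Term} {v w : Assignment} (h : ∀ x ∈ t.vars, v x = w x) :
    t.value v = t.value w := by
  refine List.flatMap_congr fun i hi => ?_
  cases i with
  | var x => exact h x hi
  | lit s => rfl

theorem update_congr {V : Set Var} {v w : Assignment} {x : Var} (h : ∀ y ∈ V \ {x}, v y = w y)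
    (s : Str) : ∀ y ∈ V, Function.update v x s y = Function.update w x s y := by
  intro y hy
  by_cases hyx : y = x
  · simp [hyx]
  · simpa [hyx] using h y ⟨hy, hyx⟩

theorem Formula.holds_congr {p : Formula} {v w : Assignment} (h : ∀ x ∈ p.freeVars, v x = w x) :
    p.Holds v ↔ p.Holds w := by
  induction p generalizing v w with
  | eq t u | ne t u =>
    simp only [Holds, Term.value_congr fun x hx => h x (.inl hx),
      Term.value_congr fun x hx => h x (.inr hx)]
  | paren p ih => exact ih h
  | neg p ih => exact not_congr (ih h)
  | and p q ihp ihq =>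
    exact and_congr (ihp fun x hx => h x (.inl hx)) (ihq fun x hx => h x (.inr hx))
  | or p q ihp ihq =>
    exact or_congr (ihp fun x hx => h x (.inl hx)) (ihq fun x hx => h x (.inr hx))
  | imp p q ihp ihq =>
    exact imp_congr (ihp fun x hx => h x (.inl hx)) (ihq fun x hx => h x (.inr hx))
  | all x p ih => exact forall_congr' fun s => ih (update_congr h s)
  | ex x p ih => exact exists_congr fun s => ih (update_congr h s)

theorem IsSentence.isTrueSentence_or_isFalseSentence {s : Str} (h : IsSentence s) :
    IsTrueSentence s ∨ IsFalseSentence s := by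
  obtain ⟨p, hs, hp⟩ := h
  by_cases hv : ∀ v, p.Holds v
  · exact .inl ⟨p, hs, hp, hv⟩
  · obtain ⟨w, hw⟩ := not_forall.1 hv
    exact .inr ⟨p, hs, hp, fun v => (Formula.holds_congr (by simp [hp])).not.2 hw⟩

theorem isTrueSentence_render_iff {p : Formula} (hp : p.WellParsed) (hv : p.freeVars = ∅) :
    IsTrueSentence p.render ↔ ∀ v, p.Holds v := by
  refine ⟨?_, fun h => ⟨p, ⟨hp, rfl⟩, hv, h⟩⟩
  rintro ⟨q, hq, -, h⟩
  rwa [ReadsAs.unique ⟨hp, rfl⟩ hq]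

/-- The variable that holds the `n`-th argument of an expressible relation. -/
def var (n : ℕ) : Var := ⟨0, List.replicate n 0⟩

theorem var_injective : Function.Injective var := fun m n h => by
  simpa [var] using congrArg (fun x => x.digits.length) h

theorem range_var_init_subset (n : ℕ) :
    Set.range (fun i : Fin n => var i) ⊆ Set.range fun i : Fin (n + 1) => var i :=
  Set.range_subset_iff.2 fun i => ⟨i.castSucc, rfl⟩

section

variable {n : ℕ}

/-- The function of `n` strings is denoted by a term in the variables `var 0, …, var (n - 1)`. -/
def IsTerm (f : (Fin n → Str) → Str) : Prop :=
  ∃ t : Term, t.vars ⊆ Set.range (fun i : Fin n => var i) ∧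
    ∀ v : Assignment, t.value v = f fun i => v (var i)

namespace IsTerm

theorem const (s : Str) : IsTerm fun _ : Fin n → Str => s :=
  ⟨⟨[.lit s], by simp⟩, by simp [Term.vars], by simp [Term.value, Item.value]⟩

theorem append {f g : (Fin n → Str) → Str} (hf : IsTerm f) (hg : IsTerm g) :
    IsTerm fun v => f v ++ g v := by
  obtain ⟨t, ht, hf⟩ := hf
  obtain ⟨u, hu, hg⟩ := hg
  refine ⟨⟨t.items ++ u.items, by simp [t.nonempty]⟩, ?_, fun v => ?_⟩
  · rintro x hx
    exact (List.mem_append.1 hx).elim (ht ·) (hu ·)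
  · simp only [← hf, ← hg]
    exact List.flatMap_append

theorem init {f : (Fin n → Str) → Str} (hf : IsTerm f) :
    IsTerm fun v : Fin (n + 1) → Str => f (Fin.init v) := by
  obtain ⟨t, ht, hf⟩ := hf
  exact ⟨t, ht.trans (range_var_init_subset n), hf⟩

theorem last : IsTerm fun v : Fin (n + 1) → Str => v (Fin.last n) :=
  ⟨⟨[.var (var n)], by simp⟩, fun x hx => ⟨Fin.last n, by simpa [Term.vars, eq_comm] using hx⟩,
    by simp [Term.value, Item.value]⟩

end IsTerm

/-- The `n`-ary relation on strings is expressed by a formula whose free variables are among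
`var 0, …, var (n - 1)`. -/
def Expressible (R : (Fin n → Str) → Prop) : Prop :=
  ∃ p : Formula, p.WellParsed ∧ p.freeVars ⊆ Set.range (fun i : Fin n => var i) ∧
    ∀ v : Assignment, p.Holds v ↔ R fun i => v (var i)

namespace Expressible

variable {R R' : (Fin n → Str) → Prop}

theorem eq {f g : (Fin n → Str) → Str} (hf : IsTerm f) (hg : IsTerm g) :
    Expressible fun v => f v = g v := by
  obtain ⟨t, ht, hf⟩ := hf
  obtain ⟨u, hu, hg⟩ := hg
  exact ⟨.eq t u, trivial, Set.union_subset ht hu, fun v => by simp only [Formula.Holds, hf, hg]⟩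

theorem not (h : Expressible R) : Expressible fun v => ¬ R v := by
  obtain ⟨p, hp, hv, h⟩ := h
  exact ⟨.neg (.paren p), ⟨hp, .inl (Nat.le_succ 4)⟩, hv, fun v => not_congr (h v)⟩

theorem and (h : Expressible R) (h' : Expressible R') : Expressible fun v => R v ∧ R' v := by
  obtain ⟨p, hp, hv, h⟩ := h
  obtain ⟨q, hq, hv', h'⟩ := h'
  exact ⟨.and (.paren p) (.paren q), ⟨hp, hq, ⟨Nat.le_add_right 3 2, id⟩, .inl (Nat.le_succ 4)⟩,
    Set.union_subset hv hv', fun v => and_congr (h v) (h' v)⟩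

theorem ex {R : (Fin n → Str) → Str → Prop}
    (h : Expressible fun v : Fin (n + 1) → Str => R (Fin.init v) (v (Fin.last n))) :
    Expressible fun v => ∃ s, R v s := by
  obtain ⟨p, hp, hv, h⟩ := h
  refine ⟨.ex (var n) p, hp, ?_, fun v => exists_congr fun s => ?_⟩
  · rintro x ⟨hx, hxn⟩
    obtain ⟨i, rfl⟩ := hv hx
    exact ⟨i.castPred fun h => hxn (by simp [h]), by simp⟩
  · have hs : (fun i : Fin n => Function.update v (var n) s (var i)) =
        fun i : Fin n => v (var i) :=
      funext fun i => Function.update_of_ne (var_injective.ne i.is_lt.ne) _ _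
    simp [h, Fin.init_def, hs]

theorem or (h : Expressible R) (h' : Expressible R') : Expressible fun v => R v ∨ R' v := by
  simpa only [not_and_or, not_not] using (h.not.and h'.not).not

theorem imp (h : Expressible R) (h' : Expressible R') : Expressible fun v => R v → R' v := by
  simpa only [imp_iff_not_or] using h.not.or h'

theorem all {R : (Fin n → Str) → Str → Prop}
    (h : Expressible fun v : Fin (n + 1) → Str => R (Fin.init v) (v (Fin.last n))) :
    Expressible fun v => ∀ s, R v s := by
  simpa only [not_exists, not_not] using (ex (R := fun v s => ¬ R v s) h.not).not

theorem exists_mem {ι : Type*} {s : Set ι} (hs : s.Finite) {R : ι → (Fin n → Str) → Prop}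
    (h : ∀ i ∈ s, Expressible (R i)) : Expressible fun v => ∃ i ∈ s, R i v := by
  induction s, hs using Set.Finite.induction_on with
  | empty => simpa using (eq (IsTerm.const []) (IsTerm.const [])).not
  | insert _ _ ih =>
    simpa only [Set.exists_mem_insert] using
      (h _ (Set.mem_insert _ _)).or (ih fun i hi => h i (Set.mem_insert_of_mem _ hi))

end Expressible

end

/-- Substituting a term for the argument of the predicate yields an expressible relation. -/
def ExpressiblePred (P : Str → Prop) : Prop :=
  ∀ ⦃n : ℕ⦄ ⦃t : (Fin n → Str) → Str⦄, IsTerm t → Expressible fun v => P (t v)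

/-- Substituting terms for both arguments of the relation yields an expressible relation. -/
def ExpressibleRel (S : Str → Str → Prop) : Prop :=
  ∀ ⦃n : ℕ⦄ ⦃t u : (Fin n → Str) → Str⦄, IsTerm t → IsTerm u → Expressible fun v => S (t v) (u v)

theorem expressibleRel_infix : ExpressibleRel (· <:+: ·) := fun _ _ _ ht hu =>
  .ex (.ex (.eq ((IsTerm.last.init.append ht.init.init).append .last) hu.init.init))

/-! ### Reflexive transitive closure -/

/-- The concatenation of the given strings, separated and enclosed by copies of `d`. -/
def history (d : Str) : List Str → Str
  | [] => d
  | w :: ws => d ++ (w ++ history d ws)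

/-- A string that does not occur in strings of length at most `k` and whose occurrences in a string
do not overlap. -/
def delimiter (k : ℕ) : Str := Ch.plus :: List.replicate k Ch.star

theorem history_eq_append (d : Str) (ws : List Str) : ∃ r, history d ws = d ++ r := by
  cases ws with
  | nil => exact ⟨[], by simp [history]⟩
  | cons w ws => exact ⟨_, rfl⟩

theorem eq_nil_of_append_delimiter_append {k : ℕ} {x r r' : Str} (hx : x.length ≤ k)
    (h : x ++ (delimiter k ++ r) = delimiter k ++ r') : x = [] := by
  rcases List.append_eq_append_iff.1 h with ⟨_ | ⟨c, y⟩, hy, hr⟩ | ⟨y, rfl, -⟩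
  · simp [← List.append_nil x ▸ hy, delimiter] at hx
  · obtain rfl : Ch.plus = c := (List.cons.inj hr).1
    rcases x with _ | ⟨c, x⟩
    · rfl
    · have hplus : Ch.plus ∈ List.replicate k Ch.star := by simp [(List.cons.inj hy).2]
      simp at hplus
  · simp only [delimiter, List.length_append, List.length_cons, List.length_replicate] at hx
    omega

theorem append_delimiter_append_eq {k : ℕ} {u w r r' : Str} (hw : w.length ≤ k)
    (h : u ++ (delimiter k ++ r) = w ++ (delimiter k ++ r')) :
    (u = w ∧ r = r') ∨ ∃ x, u = w ++ (delimiter k ++ x) ∧ r' = x ++ (delimiter k ++ r) := by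
  rcases List.append_eq_append_iff.1 h with ⟨x, rfl, hx⟩ | ⟨x, rfl, hx⟩
  · simp only [List.length_append] at hw
    obtain rfl := eq_nil_of_append_delimiter_append (by omega) hx.symm
    exact .inl ⟨by simp, by simpa using hx⟩
  · obtain hxk | hxk := le_or_gt x.length k
    · obtain rfl := eq_nil_of_append_delimiter_append hxk hx.symm
      exact .inl ⟨by simp, by simpa using hx.symm⟩
    · obtain ⟨y, rfl⟩ : delimiter k <+: x :=
        List.prefix_of_prefix_length_le ⟨r', hx⟩ ⟨_, rfl⟩ (by simpa [delimiter] using hxk)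
      exact .inr ⟨y, rfl, by simpa using hx⟩

theorem exists_of_history_eq {k : ℕ} {ws : List Str} (hws : ∀ w ∈ ws, w.length ≤ k)
    {p u r : Str} (hu : ¬ delimiter k <:+: u)
    (h : history (delimiter k) ws = p ++ (delimiter k ++ (u ++ (delimiter k ++ r)))) :
    ∃ ws₁ ws₂, ws = ws₁ ++ u :: ws₂ ∧ delimiter k ++ r = history (delimiter k) ws₂ := by
  induction ws generalizing p with
  | nil =>
    have := congrArg List.length h
    simp [history, delimiter] at this
    omega
  | cons w ws ih =>
    obtain ⟨hw, hws⟩ := List.forall_mem_cons.1 hws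
    obtain ⟨r', hr'⟩ := history_eq_append (delimiter k) ws
    suffices (u = w ∧ delimiter k ++ r = history (delimiter k) ws) ∨
        ∃ p', history (delimiter k) ws = p' ++ (delimiter k ++ (u ++ (delimiter k ++ r))) by
      rcases this with ⟨rfl, hr⟩ | ⟨p', hp'⟩
      · exact ⟨[], ws, rfl, hr⟩
      · obtain ⟨ws₁, ws₂, rfl, hr⟩ := ih hws hp'
        exact ⟨w :: ws₁, ws₂, rfl, hr⟩
    rw [hr']
    simp only [history, hr'] at h
    rcases append_delimiter_append_eq (w := []) (Nat.zero_le k) h.symm with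
      ⟨rfl, hx⟩ | ⟨x, rfl, hx⟩
    · rcases append_delimiter_append_eq hw hx with ⟨rfl, rfl⟩ | ⟨x, rfl, -⟩
      · exact .inl ⟨rfl, rfl⟩
      · exact absurd ⟨w, x, by simp⟩ hu
    · rcases append_delimiter_append_eq hw hx.symm with ⟨-, hr⟩ | ⟨y, -, rfl⟩
      · exact .inr ⟨[], by simp [hr]⟩
      · exact .inr ⟨delimiter k ++ y, by simp⟩

/-- The string `h` contains `w₀` between two copies of `d`, and each string between successive
copies of `d` in `h` is `w₁` or `S`-related to the next such string. -/
def CodesRun (S : Str → Str → Prop) (w₀ w₁ d h : Str) : Prop :=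
  ¬ d <:+: w₀ ∧ d ++ w₀ ++ d <+: h ∧ ∀ p u r, h = p ++ d ++ u ++ d ++ r → ¬ d <:+: u →
    u = w₁ ∨ ∃ u' r', r = u' ++ d ++ r' ∧ ¬ d <:+: u' ∧ S u u'

theorem CodesRun.reflTransGen {S : Str → Str → Prop} {w₀ w₁ d h : Str}
    (hc : CodesRun S w₀ w₁ d h) : Relation.ReflTransGen S w₀ w₁ := by
  obtain ⟨hw, ⟨r, hr⟩, hstep⟩ := hc
  suffices ∀ m p u r, r.length = m → h = p ++ d ++ u ++ d ++ r → ¬ d <:+: u →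
      Relation.ReflTransGen S u w₁ from this _ [] w₀ r rfl hr.symm hw
  intro m
  induction m using Nat.strong_induction_on with
  | h m ih =>
    rintro p u r rfl hr hu
    rcases hstep p u r hr hu with rfl | ⟨u', r', rfl, hu', hS⟩
    · exact .refl
    · have hd : 0 < d.length := List.length_pos_iff.2 fun h0 => hu (h0 ▸ List.nil_infix)
      exact .head hS (ih r'.length (by simp only [List.length_append]; omega) (p ++ d ++ u) u' r'
        rfl (by simp [hr]) hu')

theorem exists_codesRun {S : Str → Str → Prop} {w₀ w₁ : Str}
    (h : Relation.ReflTransGen S w₀ w₁) : ∃ d h, CodesRun S w₀ w₁ d h := by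
  obtain ⟨ws, hchain, hlast⟩ := List.exists_isChain_cons_of_relationReflTransGen h
  set k := ((w₀ :: ws).map List.length).sum
  have hlen : ∀ w ∈ w₀ :: ws, w.length ≤ k := fun w hw =>
    List.single_le_sum (by simp) _ (List.mem_map_of_mem hw)
  have hfree : ∀ w ∈ w₀ :: ws, ¬ delimiter k <:+: w := fun w hw hd => by
    have := hd.length_le.trans (hlen w hw)
    simp [delimiter] at this
  obtain ⟨r, hr⟩ := history_eq_append (delimiter k) ws
  refine ⟨delimiter k, history (delimiter k) (w₀ :: ws), hfree _ (by simp),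
    ⟨r, by simp [history, hr]⟩, fun p u r h hu => ?_⟩
  obtain ⟨ws₁, _ | ⟨u', ws₂⟩, hws, hr⟩ :=
    exists_of_history_eq hlen hu (p := p) (r := r) (by simpa using h)
  · simp only [hws] at hlast
    exact .inl (by simpa using hlast)
  · obtain ⟨r', hr'⟩ := history_eq_append (delimiter k) ws₂
    rw [hws] at hchain
    refine .inr ⟨u', r', ?_, hfree u' (by simp [hws]), ?_⟩
    · simpa [history, hr'] using hr
    · exact (List.isChain_cons_cons.1 (List.isChain_append.1 hchain).2.1).1

open IsTerm in
theorem ExpressibleRel.reflTransGen {S : Str → Str → Prop} (hS : ExpressibleRel S) :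
    ExpressibleRel (Relation.ReflTransGen S) := by
  intro n t u ht hu
  have h : ∀ w₀ w₁, Relation.ReflTransGen S w₀ w₁ ↔ ∃ d h, CodesRun S w₀ w₁ d h := fun _ _ =>
    ⟨exists_codesRun, fun ⟨_, _, h⟩ => h.reflTransGen⟩
  simp only [h]
  refine .ex (.ex (.and (expressibleRel_infix last.init ht.init.init).not (.and ?_ (.all (.all
    (.all (.imp ?_ (.imp ?_ (.or ?_ (.ex (.ex (.and ?_ (.and ?_ ?_)))))))))))))
  · exact .ex (.eq (((last.init.init.append ht.init.init.init).append
      last.init.init).append last) last.init)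
  · exact .eq last.init.init.init ((((last.init.init.append
      last.init.init.init.init).append last.init).append
      last.init.init.init.init).append last)
  · exact (expressibleRel_infix last.init.init.init.init last.init).not
  · exact .eq last.init hu.init.init.init.init.init
  · exact .eq last.init.init ((last.init.append
      last.init.init.init.init.init.init).append last)
  · exact (expressibleRel_infix last.init.init.init.init.init.init last.init).not
  · exact hS last.init.init.init last.init

/-! ### Rewriting at the first quotation mark -/

/-- The word `w'` arises from `w` by replacing the left side of a rule by its right side, where no
quotation mark precedes the replaced part. Hence a left side that contains a quotation mark matches
in at most one place. -/
def Rewrites (rules : Set (Str × Str)) (w w' : Str) : Prop :=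
  ∃ r ∈ rules, ∃ a b, Ch.quote ∉ a ∧ w = a ++ r.1 ++ b ∧ w' = a ++ r.2 ++ b

theorem expressiblePred_quote_notMem : ExpressiblePred (Ch.quote ∉ ·) := fun _ _ ht => by
  simpa only [List.singleton_infix_iff] using
    (expressibleRel_infix (.const [Ch.quote]) ht).not

open IsTerm in
theorem expressibleRel_rewrites {rules : Set (Str × Str)} (h : rules.Finite) :
    ExpressibleRel (Rewrites rules) := fun _ _ _ ht hu =>
  .exists_mem h fun _ _ => .ex (.ex (.and (expressiblePred_quote_notMem last.init)
    (.and (.eq ht.init.init ((last.init.append (.const _)).append last))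
      (.eq hu.init.init ((last.init.append (.const _)).append last)))))

instance : Finite Ch := by
  refine Set.finite_univ_iff.1 ((((Set.finite_range Ch.letter).union
    (Set.finite_range Ch.digit)).union (Set.toFinite {Ch.quote, Ch.backslash, Ch.eq, Ch.ne,
      Ch.lpar, Ch.rpar, Ch.tilde, Ch.amp, Ch.bar, Ch.minus, Ch.gt, Ch.bigA, Ch.bigE, Ch.colon,
      Ch.plus, Ch.star, Ch.lt})).subset fun c _ => ?_)
  cases c <;> simp

/-- The rules that move a quotation mark to the right and encode the characters it passes. -/
def encodeRules : Set (Str × Str) :=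
  Set.range fun c => ([Ch.quote, c], encodeChar c ++ [Ch.quote])

theorem rewrites_encodeRules_iff {s t w : Str} :
    Rewrites encodeRules (encode s ++ Ch.quote :: t) w ↔
      ∃ c t', t = c :: t' ∧ w = encode (s ++ [c]) ++ Ch.quote :: t' := by
  constructor
  · rintro ⟨-, ⟨c, rfl⟩, a, t', ha, hst, rfl⟩
    obtain ⟨rfl, -, rfl⟩ := append_cons_inj (absurd · ha) (absurd · (quote_notMem_encode s))
      (hst.trans (by simp : _ = a ++ Ch.quote :: (c :: t')))
    exact ⟨c, t', rfl, by simp [encode]⟩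
  · rintro ⟨c, t', rfl, rfl⟩
    exact ⟨_, ⟨c, rfl⟩, encode s, t', quote_notMem_encode s, by simp, by simp [encode]⟩

theorem reflTransGen_rewrites_encodeRules_iff {s w : Str} :
    ReflTransGen (Rewrites encodeRules) (Ch.quote :: s) w ↔
      ∃ s₁ s₂, s = s₁ ++ s₂ ∧ w = encode s₁ ++ Ch.quote :: s₂ := by
  constructor
  · intro h
    induction h with
    | refl => exact ⟨[], s, rfl, rfl⟩
    | tail _ h ih =>
      obtain ⟨s₁, s₂, rfl, rfl⟩ := ih
      obtain ⟨c, s₂, rfl, rfl⟩ := rewrites_encodeRules_iff.1 h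
      exact ⟨s₁ ++ [c], s₂, by simp, rfl⟩
  · rintro ⟨s₁, s₂, rfl, rfl⟩
    induction s₁ using List.reverseRecOn generalizing s₂ with
    | nil => exact .refl
    | append_singleton s₁ c ih =>
      rw [List.append_assoc]
      exact (ih (c :: s₂)).tail (rewrites_encodeRules_iff.2 ⟨c, s₂, rfl, rfl⟩)

theorem eq_encode_iff {s e : Str} :
    e = encode s ↔ Ch.quote ∉ e ∧
      ReflTransGen (Rewrites encodeRules) ([Ch.quote] ++ s) (e ++ [Ch.quote]) := by
  rw [List.singleton_append, reflTransGen_rewrites_encodeRules_iff]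
  constructor
  · rintro rfl
    exact ⟨quote_notMem_encode s, s, [], by simp, rfl⟩
  · rintro ⟨he, s₁, s₂, rfl, h⟩
    obtain ⟨rfl, -, rfl⟩ :=
      append_cons_inj (absurd · (quote_notMem_encode s₁)) (absurd · he) h
    simp

theorem expressibleRel_encode : ExpressibleRel fun s e => e = encode s := fun _ _ _ hs he => by
  simp only [eq_encode_iff]
  exact (expressiblePred_quote_notMem he).and
    ((expressibleRel_rewrites (Set.finite_range _)).reflTransGen (.append (.const _) hs)
      (he.append (.const _)))

/-! ### Turing machines as rewriting systems -/

theorem reflTransGen_map_iff {α β : Type*} {r : α → α → Prop} {p : β → β → Prop} {f : α → β}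
    (h : ∀ a a', r a a' → ReflTransGen p (f a) (f a'))
    (h' : ∀ a b, p (f a) b → ∃ a', ReflTransGen r a a' ∧ f a' = b) {a : α} {b : β} :
    ReflTransGen p (f a) b ↔ ∃ a', ReflTransGen r a a' ∧ f a' = b := by
  refine ⟨fun hb => ?_, ?_⟩
  · induction hb with
    | refl => exact ⟨a, .refl, rfl⟩
    | tail _ hbc ih =>
      obtain ⟨a', ha', rfl⟩ := ih
      obtain ⟨a'', ha'', rfl⟩ := h' _ _ hbc
      exact ⟨a'', ha'.trans ha'', rfl⟩
  · rintro ⟨a', ha', rfl⟩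
    exact ha'.lift' f h

/-- The code of a tape symbol, which extends the code `encodeChar` of characters to the blank. -/
def symbolCode : Symbol → Str
  | none => [Ch.backslash, Ch.digit 2]
  | some c => encodeChar c

theorem quote_notMem_symbolCode (c : Symbol) : Ch.quote ∉ symbolCode c := by
  cases c with
  | none => simp [symbolCode]
  | some c => exact quote_notMem_encodeChar c

theorem symbolCode_append_inj {c c' : Symbol} {m m' : Str}
    (h : symbolCode c ++ m = symbolCode c' ++ m') : c = c' ∧ m = m' := by
  rcases c with _ | c <;> rcases c' with _ | c'
  · simpa [symbolCode] using h
  · cases c' <;> simp [symbolCode, encodeChar] at h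
  · cases c <;> simp [symbolCode, encodeChar] at h
  · simpa using encodeChar_append_inj h

/-- The code of a finite sequence of tape symbols. -/
def tapeCode (X : List Symbol) : Str := X.flatMap symbolCode

theorem tapeCode_append (X Y : List Symbol) : tapeCode (X ++ Y) = tapeCode X ++ tapeCode Y :=
  List.flatMap_append

theorem tapeCode_map_some (s : Str) : tapeCode (s.map some) = encode s :=
  List.flatMap_map ..

theorem quote_notMem_tapeCode (X : List Symbol) : Ch.quote ∉ tapeCode X := by
  simp [tapeCode, quote_notMem_symbolCode]

theorem eq_cons_of_tapeCode_eq {X : List Symbol} {c : Symbol} {m : Str}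
    (h : tapeCode X = symbolCode c ++ m) : ∃ X', X = c :: X' ∧ m = tapeCode X' := by
  cases X with
  | nil => rcases c with _ | c <;> simp [tapeCode, symbolCode, encodeChar_ne_nil] at h
  | cons b X =>
    obtain ⟨rfl, rfl⟩ := symbolCode_append_inj h
    exact ⟨X, rfl, rfl⟩

theorem mk_append_none {Γ : Type*} (X : List (Option Γ)) :
    Turing.ListBlank.mk (X ++ [none]) = Turing.ListBlank.mk X :=
  Quotient.sound (.inr ⟨1, rfl⟩)

/-- The parts of the tape to the left of the head, listed from right to left, and to the right of
it, including its cell, after a movement of the head from `c`, where `b` is to the left of `c`. -/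
def Move.split (b c : Symbol) : Move → List Symbol × List Symbol
  | L => ([], [b, c])
  | R => ([c, b], [])
  | N => ([b], [c])

theorem Move.apply_write_mk₂ (d : Move) (b c c' : Symbol) (X Y : List Symbol) :
    d.apply ((Turing.Tape.mk₂ (b :: X) (c :: Y)).write c') =
      Turing.Tape.mk₂ ((d.split b c').1 ++ X) ((d.split b c').2 ++ Y) := by
  cases d <;> simp [apply, split, Turing.Tape.mk₂]

namespace TuringMachine

variable {M : TuringMachine}

/-- A finite description of a configuration: its state, the tape symbols to the left of the head,
listed from right to left, and those to the right of it, including its cell. The tape is blank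
elsewhere, but the listed symbols may be blank, too. -/
structure Snapshot (M : TuringMachine) where
  left : List Symbol
  state : Fin (M.r + 1)
  right : List Symbol

variable (M) in
/-- The description of the effect of a rule on the tape symbols `b` and `c`, with the head
on `c`. -/
def after (b : Symbol) (q : Fin (M.r + 1)) (hq : q ≠ 0) (c : Symbol) : M.Snapshot :=
  let a := M.rule c q hq
  ⟨(a.2.2.split b a.1).1, a.2.1, (a.2.2.split b a.1).2⟩

namespace Snapshot

/-- The configuration that is described. -/
def toConfig (C : M.Snapshot) : M.Config := ⟨C.state, Turing.Tape.mk₂ C.left C.right⟩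

/-- The description that additionally lists symbols further to the left and to the right. -/
def extend (C : M.Snapshot) (X Y : List Symbol) : M.Snapshot :=
  ⟨C.left ++ X, C.state, C.right ++ Y⟩

/-- A computation step, which is possible if the symbol under the head and the one to the left of it
are listed, or the listing of one more blank at either end. -/
inductive Step : M.Snapshot → M.Snapshot → Prop
  | padLeft (C : M.Snapshot) : Step C (C.extend [none] [])
  | padRight (C : M.Snapshot) : Step C (C.extend [] [none])
  | move (b : Symbol) (q : Fin (M.r + 1)) (hq : q ≠ 0) (c : Symbol) (X Y : List Symbol) :
      Step (extend ⟨[b], q, [c]⟩ X Y) ((M.after b q hq c).extend X Y)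

theorem toConfig_padLeft (C : M.Snapshot) : (C.extend [none] []).toConfig = C.toConfig := by
  simp [toConfig, extend, Turing.Tape.mk₂, mk_append_none]

theorem toConfig_padRight (C : M.Snapshot) : (C.extend [] [none]).toConfig = C.toConfig := by
  simp [toConfig, extend, Turing.Tape.mk₂, mk_append_none]

theorem step_toConfig (b : Symbol) (q : Fin (M.r + 1)) (hq : q ≠ 0) (c : Symbol)
    (X Y : List Symbol) : M.step (extend ⟨[b], q, [c]⟩ X Y).toConfig =
      some ((M.after b q hq c).extend X Y).toConfig := by
  have hc : (Turing.Tape.mk₂ (b :: X) (c :: Y)).head = c := by simp [Turing.Tape.mk₂]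
  simp [step, toConfig, extend, after, hq, hc, Move.apply_write_mk₂]

theorem Step.reflTransGen_step {C C' : M.Snapshot} (h : C.Step C') :
    ReflTransGen (fun a b => M.step a = some b) C.toConfig C'.toConfig := by
  cases h with
  | padLeft => rw [toConfig_padLeft]
  | padRight => rw [toConfig_padRight]
  | move b q hq c X Y => exact .single (step_toConfig b q hq c X Y)

theorem exists_reflTransGen_step (C : M.Snapshot) {c : M.Config}
    (hc : M.step C.toConfig = some c) : ∃ C', ReflTransGen Step C C' ∧ C'.toConfig = c := by
  have hpad : ReflTransGen Step C ((C.extend [none] []).extend [] [none]) :=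
    .tail (.single (.padLeft C)) (.padRight _)
  obtain ⟨b, X, hX⟩ := List.exists_cons_of_ne_nil (List.concat_ne_nil none C.left)
  obtain ⟨a, Y, hY⟩ := List.exists_cons_of_ne_nil (List.concat_ne_nil none C.right)
  have hC : (C.extend [none] []).extend [] [none] = extend ⟨[b], C.state, [a]⟩ X Y := by
    simp_all [extend]
  have hq : C.state ≠ 0 := fun hq => by simp [step, toConfig, hq] at hc
  rw [← toConfig_padLeft, ← toConfig_padRight, hC, step_toConfig b C.state hq] at hc
  exact ⟨_, (hC ▸ hpad).tail (.move b C.state hq a X Y), Option.some.inj hc⟩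

/-- The code of a number as a sequence of equal letters. -/
def stateCode (q : ℕ) : Str := List.replicate q (Ch.letter 0)

theorem quote_notMem_stateCode (q : ℕ) : Ch.quote ∉ stateCode q := by
  simp [stateCode]

/-- The state enclosed in quotation marks, with the codes of the tape symbols on both sides. The
left part is reversed as a string, so that the code of each symbol is found when reading away from
the quotation marks. -/
def code (C : M.Snapshot) : Str :=
  (tapeCode C.left).reverse ++ Ch.quote :: (stateCode C.state ++ Ch.quote :: tapeCode C.right)

theorem code_extend (C : M.Snapshot) (X Y : List Symbol) :
    (C.extend X Y).code = (tapeCode X).reverse ++ C.code ++ tapeCode Y := by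
  simp [code, extend, tapeCode_append]

theorem eq_extend_of_code_eq {C : M.Snapshot} {x y : Str} {b c : Symbol} {q : Fin (M.r + 1)}
    (hx : Ch.quote ∉ x) (h : C.code = x ++ code (M := M) ⟨[b], q, [c]⟩ ++ y) :
    ∃ X Y, C = extend ⟨[b], q, [c]⟩ X Y ∧ x = (tapeCode X).reverse ∧ y = tapeCode Y := by
  obtain ⟨hleft, -, h⟩ := append_cons_inj
    (absurd · (by simpa [quote_notMem_symbolCode] using hx))
    (absurd · (by simp [quote_notMem_tapeCode]))
    (h.trans (by simp [code, tapeCode] : _ = (x ++ (symbolCode b).reverse) ++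
      Ch.quote :: (stateCode q ++ Ch.quote :: (symbolCode c ++ y))))
  obtain ⟨hstate, -, hright⟩ := append_cons_inj (absurd · (quote_notMem_stateCode _))
    (absurd · (quote_notMem_stateCode _)) h
  obtain ⟨X, hX, hx⟩ := eq_cons_of_tapeCode_eq (X := C.left) (c := b) (m := x.reverse)
    (List.reverse_injective (by simpa using hleft))
  obtain ⟨Y, hY, rfl⟩ := eq_cons_of_tapeCode_eq hright
  obtain rfl : C.state = q := Fin.ext (by simpa [stateCode] using hstate)
  exact ⟨X, Y, by simp [extend, ← hX, ← hY], by simp [← hx], rfl⟩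

end Snapshot

open Snapshot

variable (M) in
/-- The computation steps of the machine as rewriting rules for codes of snapshots. -/
def rules : Set (Str × Str) :=
  Set.range fun t : Symbol × {q : Fin (M.r + 1) // q ≠ 0} × Symbol =>
    (code (M := M) ⟨[t.1], t.2.1, [t.2.2]⟩, (M.after t.1 t.2.1 t.2.1.2 t.2.2).code)

variable (M) in
/-- The relation on strings that corresponds to `Snapshot.Step`. -/
def WordStep (w w' : Str) : Prop :=
  w' = (symbolCode none).reverse ++ w ∨ w' = w ++ symbolCode none ∨ Rewrites M.rules w w'

theorem wordStep_code_iff {C : M.Snapshot} {w : Str} :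
    M.WordStep C.code w ↔ ∃ C', C.Step C' ∧ C'.code = w := by
  constructor
  · rintro (rfl | rfl | ⟨-, ⟨⟨b, ⟨q, hq⟩, c⟩, rfl⟩, x, y, hx, hC, rfl⟩)
    · exact ⟨_, .padLeft C, by simp [code_extend, tapeCode]⟩
    · exact ⟨_, .padRight C, by simp [code_extend, tapeCode]⟩
    · obtain ⟨X, Y, rfl, rfl, rfl⟩ := eq_extend_of_code_eq hx hC
      exact ⟨_, .move b q hq c X Y, code_extend ..⟩
  · rintro ⟨-, ⟨⟩ | ⟨⟩ | ⟨b, q, hq, c, X, Y⟩, rfl⟩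
    · exact .inl (by simp [code_extend, tapeCode])
    · exact .inr (.inl (by simp [code_extend, tapeCode]))
    · exact .inr (.inr ⟨_, ⟨(b, ⟨q, hq⟩, c), rfl⟩, (tapeCode X).reverse, tapeCode Y,
        by simp [quote_notMem_tapeCode], code_extend .., code_extend ..⟩)

theorem quote_quote_infix_code_iff {C : M.Snapshot} :
    [Ch.quote, Ch.quote] <:+: C.code ↔ C.state = 0 := by
  constructor
  · rintro ⟨x, y, h⟩
    have hx : Ch.quote ∉ x := by
      have hcount := congrArg (List.count Ch.quote) h
      simp only [code, List.count_append, List.count_cons, List.count_nil, List.count_reverse,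
        List.count_eq_zero.2 (quote_notMem_tapeCode _),
        List.count_eq_zero.2 (quote_notMem_stateCode _), beq_self_eq_true, if_true] at hcount
      exact List.count_eq_zero.1 (by omega)
    obtain ⟨-, -, h⟩ := append_cons_inj (absurd · (by simp [quote_notMem_tapeCode]))
      (absurd · hx) ((by simp : x ++ Ch.quote :: ([] ++ Ch.quote :: y) = _).trans h)
    obtain ⟨hstate, -, -⟩ := append_cons_inj (absurd · (quote_notMem_stateCode _))
      (absurd · List.not_mem_nil) h
    exact Fin.ext (by simpa [stateCode] using congrArg List.length hstate.symm)
  · intro h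
    exact ⟨(tapeCode C.left).reverse, tapeCode C.right, by simp [code, stateCode, h]⟩

/-- The description of the initial configuration. -/
def initSnapshot (M : TuringMachine) (s : Str) : M.Snapshot :=
  ⟨[], ⟨1, Nat.succ_lt_succ M.r_pos⟩, s.map some⟩

theorem halts_iff {s : Str} : M.Halts s ↔ ∃ w e, e = encode s ∧
    ReflTransGen M.WordStep ([Ch.quote, Ch.letter 0, Ch.quote] ++ e) w ∧
      [Ch.quote, Ch.quote] <:+: w := by
  have hconfig := fun c => reflTransGen_map_iff (f := toConfig) (fun _ _ => Step.reflTransGen_step)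
    (fun C _ => C.exists_reflTransGen_step) (a := M.initSnapshot s) (b := c)
  have hword := fun w => reflTransGen_map_iff (f := code) (a := M.initSnapshot s) (b := w)
    (fun _ _ h => .single (wordStep_code_iff.2 ⟨_, h, rfl⟩))
    (fun C w h => (wordStep_code_iff.1 h).imp fun C' h' => h'.imp_left .single)
  have hcode : [Ch.quote, Ch.letter 0, Ch.quote] ++ encode s = (M.initSnapshot s).code := by
    simp [code, initSnapshot, tapeCode_map_some, stateCode, show tapeCode [] = [] from rfl]
  constructor
  · rintro ⟨c, hc, hc0⟩
    obtain ⟨C, hC, rfl⟩ := (hconfig c).1 hc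
    exact ⟨C.code, _, rfl, hcode ▸ (hword _).2 ⟨C, hC, rfl⟩, quote_quote_infix_code_iff.2 hc0⟩
  · rintro ⟨w, -, rfl, hw, hw0⟩
    obtain ⟨C, hC, rfl⟩ := (hword w).1 (hcode ▸ hw)
    exact ⟨C.toConfig, (hconfig _).2 ⟨C, hC, rfl⟩, quote_quote_infix_code_iff.1 hw0⟩

theorem expressibleRel_wordStep : ExpressibleRel M.WordStep := fun _ _ _ ht hu =>
  .or (.eq hu ((IsTerm.const _).append ht)) (.or (.eq hu (ht.append (.const _)))
    (expressibleRel_rewrites (Set.finite_range _) ht hu))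

open IsTerm in
theorem expressiblePred_halts : ExpressiblePred M.Halts := fun _ _ ht => by
  simp only [halts_iff]
  exact .ex (.ex (.and (expressibleRel_encode ht.init.init last)
    (.and (expressibleRel_wordStep.reflTransGen ((const _).append last) last.init)
      (expressibleRel_infix (const _) last.init))))

end TuringMachine

/-! ### The fixed point theorem and the undefinability of truth -/

/-- The formula that states `p` about the string `p.render`, where `p` is a property of the value of
`var 0`. -/
def Formula.diagonal (p : Formula) : Formula :=
  .all (var 0) (.imp (.paren (.eq ⟨[.var (var 0)], by simp⟩ ⟨[.lit p.render], by simp⟩)) (.paren p))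

theorem Formula.holds_diagonal {p : Formula} {v : Assignment} :
    p.diagonal.Holds v ↔ p.Holds (Function.update v (var 0) p.render) := by
  simp [diagonal, Holds, Term.value, Item.value]

theorem Formula.WellParsed.diagonal {p : Formula} (hp : p.WellParsed) : p.diagonal.WellParsed :=
  ⟨trivial, hp, ⟨Nat.le_add_left 1 4, id⟩, .inl (Nat.le_add_left 2 3)⟩

theorem Formula.freeVars_diagonal {p : Formula} (hp : p.freeVars ⊆ {var 0}) :
    p.diagonal.freeVars = ∅ := by
  simp [diagonal, freeVars, Term.vars, Set.sdiff_eq_empty, hp]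

theorem exists_render_diagonal_eq : ∃ a b c : Str, ∀ p : Formula,
    p.diagonal.render = a ++ encode p.render ++ b ++ p.render ++ c :=
  ⟨[Ch.bigA] ++ (var 0).render ++ [Ch.colon, Ch.lpar] ++ (var 0).render ++ [Ch.eq, Ch.quote],
    [Ch.quote, Ch.rpar, Ch.minus, Ch.gt, Ch.lpar], [Ch.rpar], fun p => by
    simp [Formula.diagonal, Formula.render, Term.render, Item.render]⟩

open IsTerm in
theorem ExpressiblePred.exists_fixedPoint {P : Str → Prop} (hP : ExpressiblePred P) :
    ∃ g : Formula, g.WellParsed ∧ g.freeVars = ∅ ∧ ∀ v, g.Holds v ↔ P g.render := by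
  obtain ⟨a, b, c, hrender⟩ := exists_render_diagonal_eq
  have hdiag : Expressible fun v : Fin 1 → Str =>
      ∃ e, e = encode (v (Fin.last 0)) ∧ P (a ++ e ++ b ++ v (Fin.last 0) ++ c) :=
    .ex (.and (expressibleRel_encode last.init last)
      (hP (((((const a).append last).append (const b)).append last.init).append (const c))))
  obtain ⟨p, hp, hv, h⟩ := hdiag
  refine ⟨p.diagonal, hp.diagonal, Formula.freeVars_diagonal (hv.trans (by simp)), fun v => ?_⟩
  simp [Formula.holds_diagonal, h, hrender]

theorem not_expressiblePred_isTrueSentence : ¬ ExpressiblePred IsTrueSentence := by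
  intro h
  have h_not : ExpressiblePred fun s => ¬ IsTrueSentence s := fun _ _ ht => (h ht).not
  obtain ⟨g, hg, hv, hiff⟩ := h_not.exists_fixedPoint
  have := isTrueSentence_render_iff hg hv
  simp only [hiff, forall_const] at this
  exact iff_not_self this

theorem RecursivelyEnumerable.expressiblePred {S : Set Str} (hS : RecursivelyEnumerable S) :
    ExpressiblePred (· ∈ S) := fun _ _ ht => by
  obtain ⟨M, hM⟩ := hS
  simpa only [hM] using M.expressiblePred_halts ht

theorem not_recursivelyEnumerable_isTrueSentence :
    ¬ RecursivelyEnumerable {s | IsTrueSentence s} := fun h =>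
  not_expressiblePred_isTrueSentence h.expressiblePred

theorem ProofSystem.halts_iff_isTrueSentence {P : ProofSystem}
    (hsound : ∀ s, IsFalseSentence s → ¬ P.Proves s)
    (hcomplete : ∀ s, IsTrueSentence s → P.Proves s) (s : Str) :
    P.machine.Halts s ↔ IsTrueSentence s := by
  refine ⟨fun h => ?_, fun h => (hcomplete s h).2⟩
  have hs : IsSentence s := not_imp_not.1 (P.not_halts s) h
  exact hs.isTrueSentence_or_isFalseSentence.resolve_right fun hf => hsound s hf ⟨hs, h⟩

end StringTheory

theorem theorem1 :
    (∀ P : StringTheory.ProofSystem,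
      (∃ s : StringTheory.Str, StringTheory.IsFalseSentence s ∧ P.Proves s) ∨
      (∃ s : StringTheory.Str, StringTheory.IsTrueSentence s ∧ ¬ P.Proves s)) ∧
    ¬ StringTheory.RecursivelyEnumerable {s : StringTheory.Str | StringTheory.IsTrueSentence s} := by
  refine ⟨fun P => ?_, StringTheory.not_recursivelyEnumerable_isTrueSentence⟩
  by_contra! hP
  exact StringTheory.not_recursivelyEnumerable_isTrueSentence
    ⟨P.machine, P.halts_iff_isTrueSentence hP.1 hP.2⟩
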